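/- All rings are commutative and noetherian. For ideals $I, J$ of a ring $R$ and an $R$-module $M$, let $$\Gamma_{I,J}(M)=\{x\in M \mid I^n x\subseteq Jx \text{ for some integer } n\ge 0\},$$ which is an $R$-submodule of $M$; $\Gamma_{I,J}$ is an additive left exact functor from $R$-modules to $R$-modules. For an integer $i\ge 0$ let $H^i_{I,J}$ denote its $i$-th right derived functor. Theorem (independence of the base ring). Let $R$ and $R'$ be rings, let $I, J$ be ideals of $R$, and let $\varphi: R\to R'$ be a ring homomorphism such that $\varphi(J)=JR'$, that is, the set-theoretic image of $J$ is the whole extended ideal $JR'$. For an $R'$-module $M'$, regard $M'$ as an $R$-module through $\varphi$, and regard $H^i_{I,J}(M')$ as an $R'$-module by letting $r'\in R'$ act as the map that $H^i_{I,J}$ induces from multiplication by $r'$ on $M'$. Then for every integer $i\ge 0$ there is an isomorphism of $R'$-modules $$H^i_{I,J}(M')\;\cong\; H^i_{IR',JR'}(M'),$$ natural in the $R'$-module $M'$. -/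

import Mathlib

open CategoryTheory

universe u

noncomputable section

namespace PairLocalCohomology

section Torsion

variable {R : Type u} [CommRing R]

/-- The condition `Iⁿ x ⊆ J x` for some `n`, that is: for some `n`, every product `a x` with
`a ∈ Iⁿ` equals `b x` for some `b ∈ J`. -/
def IsPairTorsion (I J : Ideal R) {M : Type u} [AddCommGroup M] [Module R M] (x : M) : Prop :=
  ∃ n : ℕ, ∀ a ∈ I ^ n, ∃ b ∈ J, a • x = b • x

/-- `x` is torsion with respect to `(I, J)` iff `Iⁿ ⊆ Ann(x) + J` for some `n`. -/
theorem isPairTorsion_iff (I J : Ideal R) {M : Type u} [AddCommGroup M] [Module R M] (x : M) :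
    IsPairTorsion I J x ↔ ∃ n : ℕ, I ^ n ≤ LinearMap.ker (LinearMap.toSpanSingleton R M x) ⊔ J := by
  refine exists_congr fun n => forall₂_congr fun a _ => ?_
  rw [Submodule.mem_sup]
  constructor
  · rintro ⟨b, hb, h⟩
    exact ⟨a - b, by simp [sub_smul, h], b, hb, by ring⟩
  · rintro ⟨c, hc, b, hb, rfl⟩
    refine ⟨b, hb, ?_⟩
    have hc' : c • x = 0 := by simpa using hc
    rw [add_smul, hc', zero_add]

/-- The `(I, J)`-torsion submodule `Γ_{I,J}(M) = {x ∈ M | Iⁿ x ⊆ J x for some n}`. -/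
def torsionSubmodule (I J : Ideal R) (M : Type u) [AddCommGroup M] [Module R M] :
    Submodule R M where
  carrier := {x | IsPairTorsion I J x}
  zero_mem' := ⟨0, fun _ _ => ⟨0, J.zero_mem, by simp⟩⟩
  smul_mem' := by
    rintro c x ⟨n, hn⟩
    refine ⟨n, fun a ha => ?_⟩
    obtain ⟨b, hb, h⟩ := hn a ha
    exact ⟨b, hb, by rw [smul_comm a c x, smul_comm b c x, h]⟩
  add_mem' := by
    rintro x y ⟨m, hm⟩ ⟨n, hn⟩
    refine (isPairTorsion_iff I J (x + y)).2 ⟨m + n, ?_⟩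
    rw [pow_add, Ideal.mul_le]
    intro a ha a' ha'
    obtain ⟨b, hb, h⟩ := hm a ha
    obtain ⟨b', hb', h'⟩ := hn a' ha'
    refine Submodule.mem_sup.2 ⟨(a - b) * (a' - b'), ?_, a * b' + b * (a' - b'), ?_, by ring⟩
    · have h1 : ((a - b) * (a' - b')) • x = 0 := by
        rw [mul_comm, mul_smul, sub_smul a b x, h, sub_self, smul_zero]
      have h2 : ((a - b) * (a' - b')) • y = 0 := by
        rw [mul_smul, sub_smul a' b' y, h', sub_self, smul_zero]
      rw [LinearMap.mem_ker, LinearMap.toSpanSingleton_apply, smul_add, h1, h2, add_zero]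
    · exact J.add_mem (J.mul_mem_left _ hb') (J.mul_mem_right _ hb)

/-- A linear map `f : M → N` carries `Γ_{I,J}(M)` into `Γ_{I,J}(N)`. -/
theorem map_mem_torsionSubmodule (I J : Ideal R) {M N : Type u} [AddCommGroup M] [Module R M]
    [AddCommGroup N] [Module R N] (f : M →ₗ[R] N) :
    ∀ x ∈ torsionSubmodule I J M, f x ∈ torsionSubmodule I J N := by
  rintro x ⟨n, hn⟩
  refine ⟨n, fun a ha => ?_⟩
  obtain ⟨b, hb, h⟩ := hn a ha
  exact ⟨b, hb, by rw [← map_smul, ← map_smul, h]⟩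

/-- The `(I, J)`-torsion functor `Γ_{I,J}` on the category of `R`-modules; on morphisms it is
restriction to the torsion submodules. -/
def torsionFunctor (I J : Ideal R) : ModuleCat.{u} R ⥤ ModuleCat.{u} R where
  obj M := ModuleCat.of R (torsionSubmodule I J M)
  map f := ModuleCat.ofHom (f.hom.restrict (map_mem_torsionSubmodule I J f.hom))

instance torsionFunctor_additive (I J : Ideal R) : (torsionFunctor I J).Additive where
  map_add := by
    intros
    rfl

/-- Right derived functors of an additive functor between module categories are additive. -/
theorem rightDerived_additive (F : ModuleCat.{u} R ⥤ ModuleCat.{u} R) [F.Additive] (i : ℕ) :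
    (F.rightDerived i).Additive where
  map_add {X Y f g} := by
    let P := injectiveResolution X
    let Q := injectiveResolution Y
    have hf := P.isoRightDerivedObj_hom_naturality f Q (InjectiveResolution.desc f Q P)
      (InjectiveResolution.desc_commutes_zero f Q P) F i
    have hg := P.isoRightDerivedObj_hom_naturality g Q (InjectiveResolution.desc g Q P)
      (InjectiveResolution.desc_commutes_zero g Q P) F i
    have hfg := P.isoRightDerivedObj_hom_naturality (f + g) Q
      (InjectiveResolution.desc f Q P + InjectiveResolution.desc g Q P) (by
        rw [HomologicalComplex.add_f_apply, Preadditive.comp_add]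
        exact (congrArg₂ (· + ·) (InjectiveResolution.desc_commutes_zero f Q P)
          (InjectiveResolution.desc_commutes_zero g Q P)).trans
            (Preadditive.add_comp _ _ _ f g (Q.ι.f 0)).symm) F i
    rw [← cancel_mono (Q.isoRightDerivedObj F i).hom, hfg, Preadditive.add_comp, hf, hg,
      Functor.map_add, Preadditive.comp_add]

/-- The `i`-th local cohomology functor `H^i_{I,J}` with respect to `(I, J)`: the `i`-th right
derived functor of `Γ_{I,J}`. -/
def localCohomology (I J : Ideal R) (i : ℕ) : ModuleCat.{u} R ⥤ ModuleCat.{u} R :=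
  (torsionFunctor I J).rightDerived i

instance localCohomology_additive (I J : Ideal R) (i : ℕ) : (localCohomology I J i).Additive :=
  rightDerived_additive (torsionFunctor I J) i

end Torsion

section Transport

variable {R R' : Type u} [CommRing R] [CommRing R']

/-- For an additive functor `G` from `R'`-modules to `R`-modules and an `R'`-module `M`, the action
of `R'` on `G(M)` by functoriality: `r` acts as `G(r · : M → M)`. -/
def actionHom (G : ModuleCat.{u} R' ⥤ ModuleCat.{u} R) [G.Additive] (M : ModuleCat.{u} R') :
    R' →+* Module.End R (G.obj M) where
  toFun r := (G.map (ModuleCat.ofHom (LinearMap.lsmul R' M r))).hom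
  map_one' := by
    have h : ModuleCat.ofHom (LinearMap.lsmul R' M 1) = 𝟙 M := by ext; simp
    rw [h, G.map_id]
    rfl
  map_mul' r s := by
    have h : ModuleCat.ofHom (LinearMap.lsmul R' M (r * s)) =
        ModuleCat.ofHom (LinearMap.lsmul R' M s) ≫ ModuleCat.ofHom (LinearMap.lsmul R' M r) := by
      ext x
      exact mul_smul r s x
    rw [h, G.map_comp]
    rfl
  map_zero' := by
    have h : ModuleCat.ofHom (LinearMap.lsmul R' M 0) = 0 := by ext; simp
    rw [h, G.map_zero]
    rfl
  map_add' r s := by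
    have h : ModuleCat.ofHom (LinearMap.lsmul R' M (r + s)) =
        ModuleCat.ofHom (LinearMap.lsmul R' M r) + ModuleCat.ofHom (LinearMap.lsmul R' M s) := by
      ext x
      exact add_smul r s x
    rw [h, G.map_add]
    rfl

/-- An additive functor `G` from `R'`-modules to `R`-modules, regarded as a functor from
`R'`-modules to `R'`-modules: `G(M)` keeps its underlying abelian group, and `r ∈ R'` acts on it as
`G(r · : M → M)`. -/
def liftAction (G : ModuleCat.{u} R' ⥤ ModuleCat.{u} R) [G.Additive] :
    ModuleCat.{u} R' ⥤ ModuleCat.{u} R' where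
  obj M :=
    letI : Module R' (G.obj M) := Module.compHom (G.obj M) (actionHom G M)
    ModuleCat.of R' (G.obj M)
  map {M N} f :=
    letI : Module R' (G.obj M) := Module.compHom (G.obj M) (actionHom G M)
    letI : Module R' (G.obj N) := Module.compHom (G.obj N) (actionHom G N)
    ModuleCat.ofHom
      { toFun := fun x => (G.map f).hom x
        map_add' := fun x y => map_add _ x y
        map_smul' := fun r x => by
          have h : ModuleCat.ofHom (LinearMap.lsmul R' M r) ≫ f =
              f ≫ ModuleCat.ofHom (LinearMap.lsmul R' N r) := by
            ext; simp
          have h' := congrArg (fun g => g.hom x) (congrArg G.map h)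
          simp only [G.map_comp] at h'
          exact h' }
  map_id M := by
    ext x
    change (G.map (𝟙 M)).hom x = x
    rw [G.map_id]
    rfl
  map_comp f g := by
    ext x
    change (G.map (f ≫ g)).hom x = (G.map g).hom ((G.map f).hom x)
    rw [G.map_comp]
    rfl

/-- For a ring map `φ : R → R'` and ideals `I, J` of `R`, the functor `M' ↦ H^i_{I,J}(M')` on
`R'`-modules: `M'` is regarded as an `R`-module through `φ`, its local cohomology is taken over `R`,
and the result is an `R'`-module through the functoriality of `H^i_{I,J}`. -/
def localCohomologyAlong (φ : R →+* R') (I J : Ideal R) (i : ℕ) :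
    ModuleCat.{u} R' ⥤ ModuleCat.{u} R' :=
  liftAction (ModuleCat.restrictScalars.{u} φ ⋙ localCohomology I J i)

end Transport

end PairLocalCohomology

end

/-! On an `R'`-module the functors `Γ_{I,J}` and `Γ_{IR',JR'}` cut out the same elements
(`isPairTorsion_map_iff`). It remains to compare `Γ_{I,J}(P)` with `Γ_{I,J}(Q)`, where `P` and `Q`
are injective resolutions of one `R'`-module over `R'` and over `R`. The terms of `P` need not be
injective over `R`; `IsTorsionDivisible` replaces injectivity.

If `x₁, …, x_k` generate `I`, then `m` is `(I, J)`-torsion iff, for each `i`, it is killed by some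
`s` congruent to a power of `x_i` modulo `J`. This is torsion for a finite list of submonoids, which
can be handled one submonoid at a time. An injective module over a noetherian ring is torsion
divisible over any base, by Artin–Rees (`exists_pow_succ_smul_eq`). Torsion elements lift modulo a
torsion divisible submodule (`IsTorsionDivisible.exists_lift`), so exact sequences `0 ⟶ X⁰ ⟶ X¹ ⟶ ⋯`
of such modules stay exact on torsion. Applied to the acyclic cone of `P ⟶ Q`, this shows that
`Γ_{I,J}(P) ⟶ Γ_{I,J}(Q)` is a quasi-isomorphism. -/

noncomputable section

namespace PairLocalCohomology

/-! ### Torsion divisible modules, and injectives as examples. -/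

section TorsionDivisible

variable {R : Type u} [CommRing R]

/-- `x` is killed by an element of each of the submonoids in the list `T`. -/
def IsListTorsion (T : List (Submonoid R)) {M : Type u} [AddCommGroup M] [Module R M] (x : M) :
    Prop :=
  ∀ S ∈ T, ∃ s ∈ S, s • x = 0

theorem IsListTorsion.sub {T : List (Submonoid R)} {M : Type u} [AddCommGroup M] [Module R M]
    {x y : M} (hx : IsListTorsion T x) (hy : IsListTorsion T y) : IsListTorsion T (x - y) := by
  intro S hS
  obtain ⟨s, hs, hsx⟩ := hx S hS
  obtain ⟨t, ht, hty⟩ := hy S hS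
  exact ⟨s * t, S.mul_mem hs ht, by
    rw [smul_sub, mul_comm, mul_smul, hsx, mul_comm, mul_smul, hty]; simp⟩

theorem IsListTorsion.smul {T : List (Submonoid R)} {M : Type u} [AddCommGroup M] [Module R M]
    {x : M} (hx : IsListTorsion T x) (r : R) : IsListTorsion T (r • x) := by
  intro S hS
  obtain ⟨s, hs, hsx⟩ := hx S hS
  exact ⟨s, hs, by rw [smul_comm, hsx, smul_zero]⟩

theorem IsListTorsion.map {T : List (Submonoid R)} {M N : Type u} [AddCommGroup M] [Module R M]
    [AddCommGroup N] [Module R N] {x : M} (hx : IsListTorsion T x) (f : M →ₗ[R] N) :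
    IsListTorsion T (f x) := by
  intro S hS
  obtain ⟨s, hs, hsx⟩ := hx S hS
  exact ⟨s, hs, by rw [← map_smul, hsx, map_zero]⟩

theorem IsListTorsion.of_map {T : List (Submonoid R)} {M N : Type u} [AddCommGroup M] [Module R M]
    [AddCommGroup N] [Module R N] {x : M} {f : M →ₗ[R] N} (hf : Function.Injective f)
    (hx : IsListTorsion T (f x)) : IsListTorsion T x := by
  intro S hS
  obtain ⟨s, hs, hsx⟩ := hx S hS
  exact ⟨s, hs, hf (by rw [map_smul, hsx, map_zero])⟩

/-- Every torsion submodule of `M` cut out by a list of submonoids surjects onto each of its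
localizations. -/
def IsTorsionDivisible (R : Type u) [CommRing R] (M : Type u) [AddCommGroup M] [Module R M] :
    Prop :=
  ∀ (T : List (Submonoid R)) (S : Submonoid R) (x : M), IsListTorsion T x → ∀ s ∈ S,
    ∃ t ∈ S, ∃ y : M, IsListTorsion T y ∧ t • s • y = t • x

variable {A E C : Type u} [AddCommGroup A] [Module R A] [AddCommGroup E] [Module R E]
  [AddCommGroup C] [Module R C]

/-- Modulo a torsion divisible submodule, torsion elements lift to torsion elements. -/
theorem IsTorsionDivisible.exists_lift (hA : IsTorsionDivisible R A) {f : A →ₗ[R] E}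
    {g : E →ₗ[R] C} (hf : Function.Injective f) (hfg : Function.Exact f g)
    (hg : Function.Surjective g) (T : List (Submonoid R)) {c : C} (hc : IsListTorsion T c) :
    ∃ e : E, IsListTorsion T e ∧ g e = c := by
  induction T with
  | nil =>
    obtain ⟨e, rfl⟩ := hg c
    exact ⟨e, by simp [IsListTorsion], rfl⟩
  | cons S T ih =>
    obtain ⟨e, he, rfl⟩ := ih fun S' hS' => hc S' (List.mem_cons_of_mem _ hS')
    obtain ⟨s, hs, hse⟩ := hc S List.mem_cons_self
    rw [← map_smul, hfg] at hse
    obtain ⟨a, ha⟩ := hse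
    -- Here `f a = s • e` is the obstruction to `e` being `S`-torsion. Dividing `a` by `s` among the
    -- `T`-torsion elements gives a correction `b` that keeps the torsion already obtained.
    obtain ⟨t, ht, b, hb, h⟩ := hA T S a (.of_map hf (ha ▸ he.smul s)) s hs
    refine ⟨e - f b, ?_, by rw [map_sub, hfg.apply_apply_eq_zero, sub_zero]⟩
    intro S' hS'
    rcases List.mem_cons.1 hS' with rfl | hS'
    · refine ⟨t * s, mul_mem ht hs, ?_⟩
      rw [smul_sub, mul_smul, mul_smul, ← ha, ← map_smul, ← map_smul, ← map_smul, h, sub_self]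
    · exact (he.sub (hb.map f)) S' hS'

/-- Lift to a torsion element of `E`, divide there and push down. This propagates the property along
the cocycles of an exact complex. -/
theorem IsTorsionDivisible.of_exact (hA : IsTorsionDivisible R A) (hE : IsTorsionDivisible R E)
    {f : A →ₗ[R] E} {g : E →ₗ[R] C} (hf : Function.Injective f) (hfg : Function.Exact f g)
    (hg : Function.Surjective g) : IsTorsionDivisible R C := by
  intro T S c hc s hs
  obtain ⟨e, he, rfl⟩ := hA.exists_lift hf hfg hg T hc
  obtain ⟨t, ht, y, hy, h⟩ := hE T S e he s hs
  exact ⟨t, ht, g y, hy.map g, by rw [← map_smul, ← map_smul, h, map_smul]⟩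

theorem IsTorsionDivisible.of_subsingleton [Subsingleton A] : IsTorsionDivisible R A :=
  fun _ S x hx _ _ => ⟨1, S.one_mem, x, hx, Subsingleton.elim _ _⟩

theorem IsTorsionDivisible.prod (hA : IsTorsionDivisible R A) (hE : IsTorsionDivisible R E) :
    IsTorsionDivisible R (A × E) := by
  intro T S x hx s hs
  obtain ⟨t, ht, a, ha, h⟩ := hA T S x.1 (hx.map (LinearMap.fst R A E)) s hs
  obtain ⟨t', ht', e, he, h'⟩ := hE T S x.2 (hx.map (LinearMap.snd R A E)) s hs
  refine ⟨t * t', S.mul_mem ht ht', (a, e), ?_, Prod.ext ?_ ?_⟩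
  · have h0 : ((a, e) : A × E) = LinearMap.inl R A E a - LinearMap.inr R A E (-e) := by simp
    rw [h0]
    refine (ha.map _).sub (IsListTorsion.map ?_ _)
    simpa using he.smul (-1)
  · simp only [Prod.smul_fst]
    rw [mul_comm, mul_smul, h, mul_smul]
  · simp only [Prod.smul_snd]
    rw [mul_smul, h', mul_smul]

/-- Maps into an injective module extend along a linear map whose kernel they kill. -/
theorem exists_comp_eq_of_ker_le [Module.Injective R E] (k : A →ₗ[R] C) (g : A →ₗ[R] E)
    (h : LinearMap.ker k ≤ LinearMap.ker g) : ∃ l : C →ₗ[R] E, l ∘ₗ k = g := by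
  have hk : Function.Injective ((LinearMap.ker k).liftQ k le_rfl) := by
    rw [← LinearMap.ker_eq_bot]
    exact Submodule.ker_liftQ_eq_bot _ _ _ le_rfl
  obtain ⟨l, hl⟩ := Module.Injective.out _ hk ((LinearMap.ker k).liftQ g h)
  refine ⟨l, LinearMap.ext fun a => ?_⟩
  simpa using hl (Submodule.Quotient.mk a)

/-- In an injective module over a noetherian ring one can divide by `s` up to a power of `s`,
keeping control of the annihilator. -/
theorem exists_pow_succ_smul_eq [IsNoetherianRing R] [Module.Injective R E] (e : E) (s : R) :
    ∃ (n N : ℕ) (f : E), s ^ (n + 1) • f = s ^ n • e ∧ ∀ u : R, u • e = 0 → u ^ N • f = 0 := by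
  -- The annihilators of the powers of `s` form an ascending chain, which stabilizes.
  obtain ⟨n, hn⟩ : ∃ n : ℕ, ∀ r, s ^ (n + 1) * r = 0 → s ^ n * r = 0 := by
    obtain ⟨n, hn⟩ := monotone_stabilizes_iff_noetherian.2 ‹IsNoetherianRing R›
      ⟨fun n => LinearMap.ker (LinearMap.mulLeft R (s ^ n)), fun m n hmn r hr => by
        obtain ⟨k, rfl⟩ := Nat.exists_eq_add_of_le' hmn
        simp only [LinearMap.mem_ker, LinearMap.mulLeft_apply] at hr ⊢
        rw [pow_add, mul_assoc, hr, mul_zero]⟩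
    refine ⟨n, fun r hr => ?_⟩
    have hr' : r ∈ LinearMap.ker (LinearMap.mulLeft R (s ^ (n + 1))) := hr
    exact (hn (n + 1) n.le_succ).ge hr'
  let U : Ideal R := LinearMap.ker (LinearMap.toSpanSingleton R E e)
  -- Artin–Rees: `U ^ (k + 1) ⊓ (s ^ (n + 1))` lies in `U * (s ^ (n + 1))`, where `U` is the
  -- annihilator of `e`.
  obtain ⟨k, hk⟩ := Ideal.exists_pow_inf_eq_pow_smul (M := R) U (Ideal.span {s ^ (n + 1)})
  have hU : ∀ r, s ^ (n + 1) * r ∈ U ^ (k + 1) → s ^ n • r • e = 0 := by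
    intro r hr
    have h1 : s ^ (n + 1) * r ∈ (U ^ (k + 1) • ⊤ ⊓ Ideal.span {s ^ (n + 1)} : Submodule R R) :=
      ⟨by simpa using hr, Ideal.mul_mem_right _ _ (Ideal.mem_span_singleton_self _)⟩
    rw [hk (k + 1) k.le_succ, Nat.add_sub_cancel_left, pow_one] at h1
    have h2 : s ^ (n + 1) * r ∈ U * Ideal.span {s ^ (n + 1)} :=
      Submodule.smul_mono le_rfl inf_le_right h1
    obtain ⟨v, hv, h3⟩ := Ideal.mem_mul_span_singleton.1 h2
    have h4 := hn (r - v) (by rw [mul_sub, ← h3]; ring)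
    have hve : v • e = 0 := by simpa [U] using hv
    calc s ^ n • r • e = (s ^ n * (r - v)) • e + s ^ n • v • e := by
          rw [← mul_smul, ← mul_smul, ← add_smul]; ring_nf
      _ = 0 := by rw [h4, hve]; simp
  -- By `hU`, `s ^ (n + 1) ↦ s ^ n • e` is well defined on the submodule generated by `s ^ (n + 1)`
  -- in `R / U ^ (k + 1)`. Extend it to the whole quotient; the image of `1` is the required `f`,
  -- killed by `U ^ (k + 1)`.
  obtain ⟨l, hl⟩ := exists_comp_eq_of_ker_le
    ((U ^ (k + 1)).mkQ ∘ₗ LinearMap.mulLeft R (s ^ (n + 1)))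
    (LinearMap.toSpanSingleton R E (s ^ n • e)) (fun r hr => by
      rw [LinearMap.mem_ker, LinearMap.comp_apply, Submodule.mkQ_apply,
        Submodule.Quotient.mk_eq_zero] at hr
      rw [LinearMap.mem_ker, LinearMap.toSpanSingleton_apply, smul_comm]
      exact hU r hr)
  refine ⟨n, k + 1, l ((U ^ (k + 1)).mkQ 1), ?_, fun u hu => ?_⟩
  · have := LinearMap.congr_fun hl 1
    simp only [LinearMap.comp_apply, LinearMap.mulLeft_apply, LinearMap.toSpanSingleton_apply,
      one_smul, mul_one] at this
    rw [← this, ← map_smul, ← map_smul, smul_eq_mul, mul_one]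
  · rw [← map_smul, ← map_smul, smul_eq_mul, mul_one, Submodule.mkQ_apply,
      (Submodule.Quotient.mk_eq_zero _).2, map_zero]
    exact Ideal.pow_mem_pow (by simpa [U] using hu) _

/-- An injective module over a noetherian ring is torsion divisible over any base ring. -/
theorem IsTorsionDivisible.of_injective {R' : Type u} [CommRing R'] [IsNoetherianRing R']
    (φ : R →+* R') {E : Type u} [AddCommGroup E] [Module R' E] [Module.Injective R' E]
    [Module R E] (hφ : ∀ (r : R) (e : E), r • e = φ r • e) : IsTorsionDivisible R E := by
  intro T S e he s hs
  obtain ⟨n, N, f, hf, hN⟩ := exists_pow_succ_smul_eq (R := R') e (φ s)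
  -- The power `u ^ N` is harmless because a submonoid contains the powers of its elements.
  refine ⟨s ^ n, S.pow_mem hs n, f, fun S' hS' => ?_, ?_⟩
  · obtain ⟨u, hu, hue⟩ := he S' hS'
    refine ⟨u ^ N, S'.pow_mem hu N, ?_⟩
    rw [hφ, map_pow]
    exact hN _ (by rw [← hφ, hue])
  · rw [← mul_smul, ← pow_succ, hφ, hφ, map_pow, map_pow, hf]

end TorsionDivisible

/-! ### Pair torsion as list torsion, and change of rings. -/

section PairTorsion

variable {R : Type u} [CommRing R]

/-- The submonoid of elements congruent to a power of `x` modulo `J`. -/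
def powersMod (J : Ideal R) (x : R) : Submonoid R :=
  (Submonoid.powers (Ideal.Quotient.mk J x)).comap (Ideal.Quotient.mk J)

/-- Both sides amount to writing `x ^ n = s + j` with `s` killing `m` and `j ∈ J`. -/
theorem exists_mem_powersMod_smul_eq_zero_iff (J : Ideal R) (x : R) {M : Type u} [AddCommGroup M]
    [Module R M] (m : M) :
    (∃ s ∈ powersMod J x, s • m = 0) ↔
      x ∈ (LinearMap.ker (LinearMap.toSpanSingleton R M m) ⊔ J : Ideal R).radical := by
  have h : ∀ s n, Ideal.Quotient.mk J x ^ n = Ideal.Quotient.mk J s ↔ x ^ n - s ∈ J := fun s n => by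
    rw [← map_pow, Ideal.Quotient.eq]
  simp only [powersMod, Submonoid.mem_comap, Submonoid.mem_powers_iff, h, Ideal.mem_radical_iff,
    Submodule.mem_sup, LinearMap.mem_ker, LinearMap.toSpanSingleton_apply]
  constructor
  · rintro ⟨s, ⟨n, hn⟩, hs⟩
    exact ⟨n, s, hs, _, hn, by ring⟩
  · rintro ⟨n, s, hs, j, hj, e⟩
    exact ⟨s, ⟨n, by rw [← e]; simpa using hj⟩, hs⟩

/-- For finitely generated `I`, being `(I, J)`-torsion is torsion for a list of submonoids. -/
theorem exists_isListTorsion_iff [IsNoetherianRing R] (I J : Ideal R) :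
    ∃ T : List (Submonoid R), ∀ (M : Type u) [AddCommGroup M] [Module R M] (x : M),
      IsPairTorsion I J x ↔ IsListTorsion T x := by
  obtain ⟨G, hG⟩ := IsNoetherian.noetherian I
  refine ⟨G.toList.map (powersMod J), fun M _ _ m => ?_⟩
  simp only [isPairTorsion_iff, IsListTorsion, List.mem_map, Finset.mem_toList,
    forall_exists_index, and_imp, forall_apply_eq_imp_iff₂, exists_mem_powersMod_smul_eq_zero_iff]
  constructor
  · rintro ⟨n, hn⟩ x hx
    exact ⟨n, hn (Ideal.pow_mem_pow (hG ▸ Submodule.subset_span hx) n)⟩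
  · intro h
    -- As `I` is finitely generated, some power of it lies in the ideal once each generator lies in
    -- the radical.
    refine Ideal.exists_pow_le_of_le_radical_of_fg ?_ (IsNoetherian.noetherian I)
    rw [← hG]
    exact Submodule.span_le.2 h

variable {R' : Type u} [CommRing R']

/-- Torsion with respect to a pair of ideals is independent of the base ring. -/
theorem isPairTorsion_map_iff (I J : Ideal R) (φ : R →+* R')
    (hJ : φ '' (J : Set R) = (Ideal.map φ J : Set R')) {M : Type u} [AddCommGroup M] [Module R' M]
    [Module R M] (hφ : ∀ (r : R) (m : M), r • m = φ r • m) (x : M) :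
    IsPairTorsion (I.map φ) (J.map φ) x ↔ IsPairTorsion I J x := by
  constructor
  · rintro ⟨n, hn⟩
    refine ⟨n, fun a ha => ?_⟩
    obtain ⟨b, hb, h⟩ := hn (φ a) (by rw [← Ideal.map_pow]; exact Ideal.mem_map_of_mem φ ha)
    -- The multiplier found in `JR'` must come from a single element of `J`: this is where `φ(J) =
    -- JR'` enters.
    rw [← SetLike.mem_coe, ← hJ] at hb
    obtain ⟨b, hb, rfl⟩ := hb
    exact ⟨b, hb, by rw [hφ, hφ, h]⟩
  · rintro ⟨n, hn⟩
    -- In the form of an inclusion of ideals of `R'`, the condition need only be checked on the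
    -- images of elements of `I ^ n`.
    rw [isPairTorsion_iff]
    refine ⟨n, ?_⟩
    rw [← Ideal.map_pow, Ideal.map_le_iff_le_comap]
    intro a ha
    obtain ⟨b, hb, h⟩ := hn a ha
    refine Submodule.mem_sup.2 ⟨φ a - φ b, ?_, φ b, Ideal.mem_map_of_mem φ hb, by ring⟩
    rw [LinearMap.mem_ker, LinearMap.toSpanSingleton_apply, sub_smul, ← hφ, ← hφ, h, sub_self]

end PairTorsion

/-! ### Isomorphisms in homology, by elements. -/

section Homology

variable {R : Type u} [Ring R]

/-- A criterion in terms of elements for a map of short complexes of modules to induce an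
isomorphism in homology. -/
theorem isIso_homologyMap_of_elements {S₁ S₂ : ShortComplex (ModuleCat.{u} R)} (φ : S₁ ⟶ S₂)
    (hinj : ∀ x : S₁.X₂, S₁.g x = 0 → ∀ y : S₂.X₁, S₂.f y = φ.τ₂ x → ∃ z : S₁.X₁, S₁.f z = x)
    (hsurj : ∀ y : S₂.X₂, S₂.g y = 0 →
      ∃ x : S₁.X₂, S₁.g x = 0 ∧ ∃ z : S₂.X₁, S₂.f z = φ.τ₂ x - y) :
    IsIso (ShortComplex.homologyMap φ) := by
  -- Homology is a quotient of the cycles and embeds in the opcycles, where a class vanishes iff it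
  -- is a boundary.
  have hπι (S : ShortComplex (ModuleCat.{u} R)) (c : S.cycles) :
      S.homologyι (S.homologyπ c) = S.pOpcycles (S.iCycles c) :=
    ConcreteCategory.congr_hom S.homology_π_ι c
  have hφ (c : S₁.cycles) : S₂.homologyι (ShortComplex.homologyMap φ (S₁.homologyπ c)) =
      S₂.pOpcycles (φ.τ₂ (S₁.iCycles c)) := by
    have h : S₁.homologyπ ≫ ShortComplex.homologyMap φ ≫ S₂.homologyι =
        S₁.iCycles ≫ φ.τ₂ ≫ S₂.pOpcycles := by simp
    exact ConcreteCategory.congr_hom h c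
  have hι (S : ShortComplex (ModuleCat.{u} R)) : Function.Injective S.homologyι :=
    (ModuleCat.mono_iff_injective _).1 inferInstance
  have hπ (S : ShortComplex (ModuleCat.{u} R)) : Function.Surjective S.homologyπ :=
    (ModuleCat.epi_iff_surjective _).1 inferInstance
  have hmono : Mono (ShortComplex.homologyMap φ) := by
    rw [ModuleCat.mono_iff_injective]
    refine (injective_iff_map_eq_zero _).2 fun h hh => ?_
    obtain ⟨c, rfl⟩ := hπ S₁ h
    have h1 := hφ c
    rw [hh, map_zero, eq_comm, ShortComplex.moduleCat_pOpcycles_eq_zero_iff] at h1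
    obtain ⟨y, hy⟩ := h1
    obtain ⟨z, hz⟩ := hinj (S₁.iCycles c) (ConcreteCategory.congr_hom S₁.iCycles_g c) y hy
    refine hι S₁ ?_
    rw [hπι, map_zero, ShortComplex.moduleCat_pOpcycles_eq_zero_iff]
    exact ⟨z, hz⟩
  have hepi : Epi (ShortComplex.homologyMap φ) := by
    rw [ModuleCat.epi_iff_surjective]
    intro h
    obtain ⟨c, rfl⟩ := hπ S₂ h
    obtain ⟨x, hx, z, hz⟩ := hsurj (S₂.iCycles c) (ConcreteCategory.congr_hom S₂.iCycles_g c)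
    let k : S₁.moduleCatLeftHomologyData.K := (⟨x, hx⟩ : LinearMap.ker S₁.g.hom)
    refine ⟨S₁.homologyπ (S₁.moduleCatCyclesIso.inv k), hι S₂ ?_⟩
    have hk : S₁.iCycles (S₁.moduleCatCyclesIso.inv k) = x :=
      ConcreteCategory.congr_hom S₁.moduleCatCyclesIso_inv_iCycles k
    rw [hφ, hπι, hk, ShortComplex.moduleCat_pOpcycles_eq_iff]
    exact ⟨z, hz⟩
  exact isIso_of_mono_of_epi _

end Homology

/-! ### The mapping cone and its torsion. -/

section Comparison

variable {R : Type u} [CommRing R]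

/-- An exact sequence of torsion divisible modules remains exact on torsion elements. -/
theorem IsTorsionDivisible.exists_torsion_preimage {X : ℕ → ModuleCat.{u} R}
    (hX : ∀ n, IsTorsionDivisible R (X n)) (d : ∀ n, X n →ₗ[R] X (n + 1))
    (h0 : Function.Injective (d 0)) (hd : ∀ n, Function.Exact (d n) (d (n + 1)))
    (T : List (Submonoid R)) (n : ℕ) (x : X (n + 1)) (hx : IsListTorsion T x)
    (hdx : d (n + 1) x = 0) : ∃ y : X n, IsListTorsion T y ∧ d n y = x := by
  have hg (n : ℕ) (y : X n) : d n y ∈ LinearMap.ker (d (n + 1)) := (hd n).apply_apply_eq_zero y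
  have hfg (n : ℕ) : Function.Exact (LinearMap.ker (d n)).subtype
      ((d n).codRestrict (LinearMap.ker (d (n + 1))) (hg n)) := by
    intro y
    simp [Subtype.ext_iff]
  have hsurj (n : ℕ) : Function.Surjective
      ((d n).codRestrict (LinearMap.ker (d (n + 1))) (hg n)) := by
    rintro ⟨y, hy⟩
    obtain ⟨z, hz⟩ := (hd n y).1 hy
    exact ⟨z, Subtype.ext hz⟩
  -- Induct along `0 ⟶ ker (d n) ⟶ X n ⟶ ker (d (n + 1)) ⟶ 0`, starting from `ker (d 0) = 0`.
  have hker (n : ℕ) : IsTorsionDivisible R (LinearMap.ker (d n)) := by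
    induction n with
    | zero =>
      rw [← LinearMap.ker_eq_bot] at h0
      rw [h0]
      exact .of_subsingleton
    | succ n ih => exact ih.of_exact (hX n) (Submodule.subtype_injective _) (hfg n) (hsurj n)
  obtain ⟨y, hy, h⟩ := (hker n).exists_lift (Submodule.subtype_injective _) (hfg n) (hsurj n) T
    (c := ⟨x, hdx⟩) (.of_map (f := (LinearMap.ker (d (n + 1))).subtype)
      (Submodule.subtype_injective _) hx)
  exact ⟨y, hy, congrArg Subtype.val h⟩

variable {K Q : CochainComplex (ModuleCat.{u} R) ℕ}

/-- The terms of the mapping cone of a map of complexes `K ⟶ Q` in nonnegative degrees. -/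
def coneX (K Q : CochainComplex (ModuleCat.{u} R) ℕ) : ℕ → ModuleCat.{u} R
  | 0 => K.X 0
  | n + 1 => ModuleCat.of R (K.X (n + 1) × Q.X n)

/-- The differentials of the mapping cone. -/
def coneD (f : K ⟶ Q) : ∀ n, coneX K Q n →ₗ[R] coneX K Q (n + 1)
  | 0 => (K.d 0 1).hom.prod (f.f 0).hom
  | n + 1 => LinearMap.prod ((K.d (n + 1) (n + 2)).hom ∘ₗ LinearMap.fst R _ _)
      ((f.f (n + 1)).hom ∘ₗ LinearMap.fst R _ _ - (Q.d n (n + 1)).hom ∘ₗ LinearMap.snd R _ _)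

section Exact

variable {A : ModuleCat.{u} R} (f : K ⟶ Q) (ι : A ⟶ K.X 0) (κ : A ⟶ Q.X 0) (hικ : ι ≫ f.f 0 = κ)
  (hκ : Function.Injective κ) (hι : Function.Exact ι (K.d 0 1))
  (hκ' : Function.Exact κ (Q.d 0 1))
  (hK : ∀ n, Function.Exact (K.d n (n + 1)) (K.d (n + 1) (n + 2)))
  (hQ : ∀ n, Function.Exact (Q.d n (n + 1)) (Q.d (n + 1) (n + 2)))

theorem comm_apply (m n : ℕ) (x : K.X m) : Q.d m n (f.f m x) = f.f n (K.d m n x) :=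
  ConcreteCategory.congr_hom (f.comm m n) x

theorem d_d_apply (K : CochainComplex (ModuleCat.{u} R) ℕ) (l m n : ℕ) (x : K.X l) :
    K.d m n (K.d l m x) = 0 :=
  ConcreteCategory.congr_hom (K.d_comp_d l m n) x

-- A cocycle of `K` in degree zero comes from `A`, and there `f` restricts to the injective map `κ`.
include hικ hκ hι in
theorem coneD_zero_injective : Function.Injective (coneD f 0) := by
  refine (injective_iff_map_eq_zero _).2 fun x hx => ?_
  have h1 : K.d 0 1 x = 0 := congrArg Prod.fst hx
  have h2 : f.f 0 x = 0 := congrArg Prod.snd hx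
  obtain ⟨a, rfl⟩ := (hι x).1 h1
  have h3 : κ a = 0 := by rw [← hικ]; exact h2
  rw [(injective_iff_map_eq_zero κ.hom).1 hκ a h3]
  exact map_zero ι.hom

-- For a cocycle `(a, b)` write `a = d a'`. Then `f a' - b` is a cocycle of `Q`, so it is a boundary
-- or, in degree zero, comes from `A`. Using the bounding element as second component, or correcting
-- `a'` by `ι`, gives a preimage.
include hικ hι hκ' hK hQ in
theorem coneD_exact (n : ℕ) : Function.Exact (coneD f n) (coneD f (n + 1)) := by
  intro x
  obtain ⟨a, b⟩ : K.X (n + 1) × Q.X n := x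
  constructor
  · intro h
    have h1 : K.d (n + 1) (n + 2) a = 0 := congrArg Prod.fst h
    have h2 : f.f (n + 1) a = Q.d n (n + 1) b := sub_eq_zero.1 (congrArg Prod.snd h)
    obtain ⟨a', rfl⟩ := (hK n a).1 h1
    have h3 : Q.d n (n + 1) (f.f n a' - b) = 0 := by
      rw [map_sub, comm_apply, h2, sub_self]
    cases n with
    | zero =>
      obtain ⟨x, hx⟩ := (hκ' _).1 h3
      have hx' : f.f 0 (ι x) = f.f 0 a' - b := by rw [← hx, ← hικ]; rfl
      refine ⟨(a' - ι x : K.X 0), Prod.ext ?_ ?_⟩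
      · change K.d 0 1 (a' - ι x) = K.d 0 1 a'
        rw [map_sub, hι.apply_apply_eq_zero, sub_zero]
      · change f.f 0 (a' - ι x) = b
        rw [map_sub, hx', sub_sub_cancel]
    | succ n =>
      obtain ⟨q, hq⟩ := (hQ n _).1 h3
      refine ⟨((a', q) : K.X (n + 1) × Q.X n), Prod.ext rfl ?_⟩
      change f.f (n + 1) a' - Q.d n (n + 1) q = b
      rw [hq, sub_sub_cancel]
  · rintro ⟨y, hy⟩
    cases n with
    | zero =>
      revert hy
      revert y
      intro (y : K.X 0) hy
      have h1 : K.d 0 1 y = a := congrArg Prod.fst hy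
      have h2 : f.f 0 y = b := congrArg Prod.snd hy
      refine Prod.ext ?_ ?_
      · change K.d 1 2 a = 0
        rw [← h1, d_d_apply]
      · change f.f 1 a - Q.d 0 1 b = 0
        rw [← h1, ← h2, comm_apply, sub_self]
    | succ n =>
      obtain ⟨c, q⟩ : K.X (n + 1) × Q.X n := y
      have h1 : K.d (n + 1) (n + 2) c = a := congrArg Prod.fst hy
      have h2 : f.f (n + 1) c - Q.d n (n + 1) q = b := congrArg Prod.snd hy
      refine Prod.ext ?_ ?_
      · change K.d (n + 2) (n + 3) a = 0
        rw [← h1, d_d_apply]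
      · change f.f (n + 2) a - Q.d (n + 1) (n + 2) b = 0
        rw [← h1, ← h2, map_sub, comm_apply, d_d_apply, sub_zero, sub_self]

variable (hKP : ∀ n, IsTorsionDivisible R (K.X n)) (hQP : ∀ n, IsTorsionDivisible R (Q.X n))

include hKP hQP in
theorem coneX_isTorsionDivisible : ∀ n, IsTorsionDivisible R (coneX K Q n)
  | 0 => hKP 0
  | n + 1 => (hKP (n + 1)).prod (hQP n)

include hικ hκ hι hκ' hK hQ hKP hQP in
/-- A map between resolutions by torsion divisible modules becomes a quasi-isomorphism after
applying the torsion functor of a pair of ideals. -/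
theorem isIso_homologyMap_torsionFunctor [IsNoetherianRing R] (I J : Ideal R) (n : ℕ) :
    IsIso (HomologicalComplex.homologyMap
      (((torsionFunctor I J).mapHomologicalComplex (ComplexShape.up ℕ)).map f) n) := by
  obtain ⟨T, hT⟩ := exists_isListTorsion_iff I J
  have key := IsTorsionDivisible.exists_torsion_preimage (coneX_isTorsionDivisible hKP hQP)
    (coneD f) (coneD_zero_injective f ι κ hικ hκ hι) (coneD_exact f ι κ hικ hι hκ' hK hQ) T
  have hpair (n : ℕ) (a : K.X (n + 1)) (b : Q.X n) (ha : IsListTorsion T a)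
      (hb : IsListTorsion T b) : IsListTorsion T (M := coneX K Q (n + 1)) (a, b) := by
    have h0 : ((a, b) : K.X (n + 1) × Q.X n) =
        LinearMap.inl R _ _ a - LinearMap.inr R _ _ (-b) := by simp
    refine h0 ▸ (ha.map _).sub (IsListTorsion.map ?_ _)
    simpa using hb.smul (-1)
  rw [← quasiIsoAt_iff_isIso_homologyMap]
  cases n with
  | zero =>
    -- Degree `0` has no predecessor, so its `prev` is `0` by default, and the incoming differential
    -- `d 0 0` is zero.
    rw [quasiIsoAt_iff' _ 0 0 1 (by simp) (by simp), ShortComplex.quasiIso_iff]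
    apply isIso_homologyMap_of_elements
    · rintro ⟨x, hx⟩ hdx ⟨y, hy⟩ hxy
      refine ⟨0, Subtype.ext ?_⟩
      have h1 : K.d 0 1 x = 0 := congrArg Subtype.val hdx
      have h2 : Q.d 0 0 y = f.f 0 x := congrArg Subtype.val hxy
      rw [Q.shape 0 0 (by simp)] at h2
      have h3 : x = 0 := coneD_zero_injective f ι κ hικ hκ hι
        ((Prod.ext h1 h2.symm : coneD f 0 x = (0 : K.X 1 × Q.X 0)).trans
          (map_zero (coneD f 0)).symm)
      exact (congrArg Subtype.val (map_zero _)).trans h3.symm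
    · rintro ⟨y, hy⟩ hdy
      have h1 : Q.d 0 1 y = 0 := congrArg Subtype.val hdy
      obtain ⟨x, hx, h⟩ := key 0 ((0, y) : K.X 1 × Q.X 0)
        (hpair 0 0 y (fun S _ => ⟨1, S.one_mem, smul_zero _⟩) ((hT _ _).1 hy)) (Prod.ext
          (map_zero (K.d 1 2).hom) (by
            change f.f 1 0 - Q.d 0 1 y = 0
            rw [map_zero, h1, sub_zero]))
      refine ⟨⟨x, (hT _ _).2 hx⟩, Subtype.ext (congrArg Prod.fst h), 0, Subtype.ext ?_⟩
      have h2 : f.f 0 x = y := congrArg Prod.snd h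
      change Q.d 0 0 0 = f.f 0 x - y
      rw [h2, map_zero, sub_self]
  | succ n =>
    rw [quasiIsoAt_iff' _ n (n + 1) (n + 2) (by simp) (by simp), ShortComplex.quasiIso_iff]
    apply isIso_homologyMap_of_elements
    · rintro ⟨x, hx⟩ hdx ⟨y, hy⟩ hxy
      have h1 : K.d (n + 1) (n + 2) x = 0 := congrArg Subtype.val hdx
      have h2 : Q.d n (n + 1) y = f.f (n + 1) x := congrArg Subtype.val hxy
      -- The relation `f x = d y` makes `(x, y)` a torsion cocycle of the cone; the `K`-component of
      -- a torsion preimage bounds `x`.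
      obtain ⟨z, hz, h⟩ := key n ((x, y) : K.X (n + 1) × Q.X n)
        (hpair n x y ((hT _ _).1 hx) ((hT _ _).1 hy)) (Prod.ext h1 (sub_eq_zero.2 h2.symm))
      cases n with
      | zero => exact ⟨⟨z, (hT _ _).2 hz⟩, Subtype.ext (congrArg Prod.fst h)⟩
      | succ n =>
        exact ⟨⟨z.1, (hT _ _).2 (hz.map (LinearMap.fst R (K.X (n + 1)) (Q.X n)))⟩,
          Subtype.ext (congrArg Prod.fst h)⟩
    · rintro ⟨y, hy⟩ hdy
      have h1 : Q.d (n + 1) (n + 2) y = 0 := congrArg Subtype.val hdy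
      -- A torsion preimage `(x, z)` of `(0, y)` satisfies `d x = 0` and `f x - d z = y`, so `x`
      -- represents the class of `y`.
      obtain ⟨⟨x, z⟩, hx, h⟩ := key (n + 1) ((0, y) : K.X (n + 2) × Q.X (n + 1))
        (hpair (n + 1) 0 y (fun S _ => ⟨1, S.one_mem, smul_zero _⟩) ((hT _ _).1 hy)) (Prod.ext
          (map_zero (K.d (n + 2) (n + 3)).hom) (by
            change f.f (n + 2) 0 - Q.d (n + 1) (n + 2) y = 0
            rw [map_zero, h1, sub_zero]))
      refine ⟨⟨x, (hT _ _).2 (hx.map (LinearMap.fst R (K.X (n + 1)) (Q.X n)))⟩,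
        Subtype.ext (congrArg Prod.fst h),
        ⟨z, (hT _ _).2 (hx.map (LinearMap.snd R (K.X (n + 1)) (Q.X n)))⟩, Subtype.ext ?_⟩
      have h2 : f.f (n + 1) x - Q.d n (n + 1) z = y := congrArg Prod.snd h
      change Q.d n (n + 1) z = f.f (n + 1) x - y
      rw [← h2, sub_sub_cancel]

end Exact

end Comparison

/-! ### Comparison maps from resolutions to injective resolutions. -/

section Resolutions

open Limits

variable {D : Type*} [Category* D] [Abelian D]

/-- The augmentation `A ⟶ I⁰` of an injective resolution. -/
def augmentation {A : D} (I : InjectiveResolution A) : A ⟶ I.cocomplex.X 0 := I.ι.f 0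

theorem augmentation_comp_d {A : D} (I : InjectiveResolution A) :
    augmentation I ≫ I.cocomplex.d 0 1 = 0 :=
  I.ι_f_zero_comp_complex_d

theorem augmentation_comp_desc {A B : D} (g : A ⟶ B) (I : InjectiveResolution B)
    (J : InjectiveResolution A) :
    augmentation J ≫ (InjectiveResolution.desc g I J).f 0 = g ≫ augmentation I :=
  InjectiveResolution.desc_commutes_zero g I J

/-- `0 ⟶ A ⟶ K⁰ ⟶ K¹ ⟶ ⋯` is exact. -/
structure IsResolution (K : CochainComplex D ℕ) {A : D} (ι : A ⟶ K.X 0) : Prop where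
  mono : Mono ι
  w : ι ≫ K.d 0 1 = 0
  exact₀ : (ShortComplex.mk ι (K.d 0 1) w).Exact
  exact_succ (n : ℕ) : (ShortComplex.mk _ _ (K.d_comp_d n (n + 1) (n + 2))).Exact

theorem isResolution_of_injectiveResolution {A : D} (I : InjectiveResolution A) :
    IsResolution I.cocomplex (augmentation I) where
  mono := inferInstanceAs (Mono (I.ι.f 0))
  w := augmentation_comp_d I
  exact₀ := I.exact₀
  exact_succ := I.exact_succ

variable {K : CochainComplex D ℕ} {A : D} {ι : A ⟶ K.X 0}

/-- The functor `L` need not preserve injectives. Being a resolution survives, and the source of a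
comparison map needs no more. -/
theorem IsResolution.map {E : Type*} [Category* E] [Abelian E] (h : IsResolution K ι) (L : D ⥤ E)
    [L.Additive] [L.PreservesHomology] [L.PreservesMonomorphisms] :
    IsResolution ((L.mapHomologicalComplex _).obj K) (L.map ι) where
  mono := have := h.mono; L.map_mono ι
  w := by
    change L.map ι ≫ L.map (K.d 0 1) = 0
    rw [← L.map_comp, h.w, L.map_zero]
  exact₀ := h.exact₀.map L
  exact_succ n := (h.exact_succ n).map L

/-- A morphism extends to a map from a resolution to an injective resolution. -/
theorem IsResolution.exists_desc (h : IsResolution K ι) {Y : D} (I : InjectiveResolution Y)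
    (g : A ⟶ Y) : ∃ φ : K ⟶ I.cocomplex, ι ≫ φ.f 0 = g ≫ augmentation I := by
  have := h.mono
  let φ₀ : K.X 0 ⟶ I.cocomplex.X 0 := Injective.factorThru (g ≫ augmentation I) ι
  have h₀ : ι ≫ φ₀ = g ≫ augmentation I := Injective.comp_factorThru _ _
  let φ₁ : K.X 1 ⟶ I.cocomplex.X 1 := h.exact₀.descToInjective (φ₀ ≫ I.cocomplex.d 0 1) (by
    change ι ≫ φ₀ ≫ I.cocomplex.d 0 1 = 0
    rw [reassoc_of% h₀, augmentation_comp_d, comp_zero])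
  have h₁ : K.d 0 1 ≫ φ₁ = φ₀ ≫ I.cocomplex.d 0 1 := h.exact₀.comp_descToInjective _ _
  refine ⟨CochainComplex.mkHom _ _ φ₀ φ₁ h₁.symm fun n ⟨g, g', w⟩ =>
    ⟨(h.exact_succ n).descToInjective (g' ≫ I.cocomplex.d (n + 1) (n + 2)) ?_,
      ((h.exact_succ n).comp_descToInjective _ _).symm⟩, ?_⟩
  · change K.d n (n + 1) ≫ g' ≫ _ = 0
    rw [← reassoc_of% w, HomologicalComplex.d_comp_d, comp_zero]
  · simpa using h₀

/-- A map from a resolution to a complex of injectives which vanishes on the resolved object is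
homotopic to zero. -/
theorem IsResolution.exists_homotopy_zero (h : IsResolution K ι) {I : CochainComplex D ℕ}
    [∀ n, Injective (I.X n)] (φ : K ⟶ I) (hφ : ι ≫ φ.f 0 = 0) : Nonempty (Homotopy φ 0) := by
  let s₀ : K.X 1 ⟶ I.X 0 := h.exact₀.descToInjective (φ.f 0) hφ
  have h₀ : K.d 0 1 ≫ s₀ = φ.f 0 := h.exact₀.comp_descToInjective _ _
  let s₁ : K.X 2 ⟶ I.X 1 := (h.exact_succ 0).descToInjective (φ.f 1 - s₀ ≫ I.d 0 1) (by
    change K.d 0 1 ≫ (φ.f 1 - s₀ ≫ I.d 0 1) = 0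
    rw [Preadditive.comp_sub, reassoc_of% h₀, φ.comm, sub_self])
  have h₁ : K.d 1 2 ≫ s₁ = φ.f 1 - s₀ ≫ I.d 0 1 := (h.exact_succ 0).comp_descToInjective _ _
  refine ⟨Homotopy.mkCoinductive _ s₀ h₀.symm s₁ (by rw [h₁]; abel) fun n ⟨g, g', w⟩ =>
    ⟨(h.exact_succ (n + 1)).descToInjective (φ.f (n + 2) - g' ≫ I.d _ _) ?_, ?_⟩⟩
  · change K.d (n + 1) (n + 2) ≫ (φ.f (n + 2) - g' ≫ I.d _ _) = 0
    rw [Preadditive.comp_sub, ← φ.comm, w, Preadditive.add_comp, Category.assoc, Category.assoc,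
      I.d_comp_d, comp_zero, zero_add, sub_self]
  · have := (h.exact_succ (n + 1)).comp_descToInjective (φ.f (n + 2) - g' ≫ I.d _ _) (by
      change K.d (n + 1) (n + 2) ≫ (φ.f (n + 2) - g' ≫ I.d _ _) = 0
      rw [Preadditive.comp_sub, ← φ.comm, w, Preadditive.add_comp, Category.assoc, Category.assoc,
        I.d_comp_d, comp_zero, zero_add, sub_self])
    rw [this]
    abel

theorem IsResolution.exists_homotopy (h : IsResolution K ι) {I : CochainComplex D ℕ}
    [∀ n, Injective (I.X n)] (φ ψ : K ⟶ I) (hφ : ι ≫ φ.f 0 = ι ≫ ψ.f 0) :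
    Nonempty (Homotopy φ ψ) := by
  obtain ⟨H⟩ := h.exists_homotopy_zero (φ - ψ) (by simp [hφ])
  exact ⟨Homotopy.equivSubZero.symm H⟩

end Resolutions

/-! ### Derived functors of composites with exact functors. -/

section DerivedComp

theorem comp_three_squares {B : Type*} [Category* B] {X X' Y Y' Z Z' W W' : B} {a : X ⟶ X'} {b : Y ⟶ Y'} {c : Z ⟶ Z'}
    {d : W ⟶ W'} {p : X ⟶ Y} {p' : X' ⟶ Y'} {q : Y ⟶ Z} {q' : Y' ⟶ Z'} {r : Z ⟶ W} {r' : Z' ⟶ W'}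
    (h₁ : a ≫ p' = p ≫ b) (h₂ : b ≫ q' = q ≫ c) (h₃ : r ≫ d = c ≫ r') :
    a ≫ p' ≫ q' ≫ r' = (p ≫ q ≫ r) ≫ d := by
  rw [reassoc_of% h₁, reassoc_of% h₂, Category.assoc, Category.assoc, h₃]

theorem comp_triangles {B : Type*} [Category* B] {X X' Y Y' Z Z' : B} {a : X ⟶ Y} {a' : X' ⟶ Y'}
    {b : X ⟶ Z} {b' : X' ⟶ Z'} {g : X ⟶ X'} {p : Y ⟶ Y'} {q : Z ⟶ Z'} {f : Y ⟶ Z} {f' : Y' ⟶ Z'}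
    (hp : a ≫ p = g ≫ a') (hf : a ≫ f = b) (hq : b ≫ q = g ≫ b') (hf' : a' ≫ f' = b') :
    a ≫ p ≫ f' = a ≫ f ≫ q := by
  rw [reassoc_of% hp, hf', reassoc_of% hf, hq]

variable {C D B : Type*} [Category* C] [Abelian C] [EnoughInjectives C]
  [Category* D] [Abelian D] [Category* B] [Abelian B]

/-- Precomposition with an exact functor commutes with right derived functors, if the functor
inverts the comparison maps between resolutions. -/
theorem nonempty_rightDerived_comp_iso [EnoughInjectives D] (L : C ⥤ D) [L.Additive] [L.PreservesHomology]
    [L.PreservesMonomorphisms] (F : D ⥤ B) [F.Additive] (n : ℕ)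
    (hF : ∀ (M : C) (P : InjectiveResolution M) (Q : InjectiveResolution (L.obj M))
      (f : (L.mapHomologicalComplex _).obj P.cocomplex ⟶ Q.cocomplex),
      L.map (augmentation P) ≫ f.f 0 = augmentation Q →
      IsIso (HomologicalComplex.homologyMap ((F.mapHomologicalComplex _).map f) n)) :
    Nonempty ((L ⋙ F).rightDerived n ≅ L ⋙ F.rightDerived n) := by
  have hP (M : C) := (isResolution_of_injectiveResolution (injectiveResolution M)).map L
  have hex (M : C) := (hP M).exists_desc (injectiveResolution (L.obj M)) (𝟙 _)
  choose f hf using hex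
  simp only [Category.id_comp] at hf
  have (M : C) := hF M _ _ (f M) (hf M)
  refine ⟨NatIso.ofComponents (fun M => (injectiveResolution M).isoRightDerivedObj (L ⋙ F) n ≪≫
    (asIso (HomologicalComplex.homologyMap ((F.mapHomologicalComplex _).map (f M)) n) :) ≪≫
    ((injectiveResolution (L.obj M)).isoRightDerivedObj F n).symm) ?_⟩
  intro M N g
  let gP := InjectiveResolution.desc g (injectiveResolution N) (injectiveResolution M)
  let gQ := InjectiveResolution.desc (L.map g) (injectiveResolution (L.obj N))
    (injectiveResolution (L.obj M))
  have hgP := augmentation_comp_desc g (injectiveResolution N) (injectiveResolution M)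
  have hgQ := augmentation_comp_desc (L.map g) (injectiveResolution (L.obj N))
    (injectiveResolution (L.obj M))
  have hLgP : L.map (augmentation (injectiveResolution M)) ≫ L.map (gP.f 0) =
      L.map g ≫ L.map (augmentation (injectiveResolution N)) := by
    rw [← L.map_comp, hgP, L.map_comp]
  -- The comparison maps `f` are natural only up to homotopy: both composites restrict to the same
  -- map on `L.obj M`.
  obtain ⟨H⟩ := (hP M).exists_homotopy ((L.mapHomologicalComplex _).map gP ≫ f N) (f M ≫ gQ)
    (comp_triangles hLgP (hf M) hgQ (hf N))
  have h := (F.mapHomotopy H).homologyMap_eq n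
  rw [Functor.map_comp, Functor.map_comp, HomologicalComplex.homologyMap_comp,
    HomologicalComplex.homologyMap_comp] at h
  exact comp_three_squares
    (InjectiveResolution.isoRightDerivedObj_hom_naturality g _ _ gP hgP (L ⋙ F) n) h
    (InjectiveResolution.isoRightDerivedObj_inv_naturality (L.map g) _ _ gQ hgQ F n)

/-- Postcomposition with an exact functor commutes with right derived functors. -/
theorem nonempty_comp_rightDerived_iso (G : C ⥤ D) [G.Additive] (L : D ⥤ B) [L.Additive]
    [L.PreservesHomology] (n : ℕ) :
    Nonempty ((G ⋙ L).rightDerived n ≅ G.rightDerived n ⋙ L) := by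
  let e (K : CochainComplex D ℕ) : ((L.mapHomologicalComplex _).obj K).homology n ≅
    L.obj (K.homology n) := (K.sc n).mapHomologyIso L
  have he {K K' : CochainComplex D ℕ} (φ : K ⟶ K') :
      HomologicalComplex.homologyMap ((L.mapHomologicalComplex _).map φ) n ≫ (e K').hom =
        (e K).hom ≫ L.map (HomologicalComplex.homologyMap φ n) :=
    ShortComplex.mapHomologyIso_hom_naturality
      ((HomologicalComplex.shortComplexFunctor _ _ n).map φ) L
  refine ⟨NatIso.ofComponents (fun M => (injectiveResolution M).isoRightDerivedObj (G ⋙ L) n ≪≫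
    (e ((G.mapHomologicalComplex _).obj (injectiveResolution M).cocomplex) :) ≪≫
    L.mapIso ((injectiveResolution M).isoRightDerivedObj G n).symm) ?_⟩
  intro M N g
  have hg := augmentation_comp_desc g (injectiveResolution N) (injectiveResolution M)
  have h := congrArg L.map
    (InjectiveResolution.isoRightDerivedObj_inv_naturality g _ _ _ hg G n)
  rw [L.map_comp, L.map_comp] at h
  exact comp_three_squares
    (InjectiveResolution.isoRightDerivedObj_hom_naturality g _ _ _ hg (G ⋙ L) n)
    (he ((G.mapHomologicalComplex _).map _)) h

/-- Naturally isomorphic functors have isomorphic right derived functors. -/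
def rightDerivedIso {F G : C ⥤ D} [F.Additive] [G.Additive] (α : F ≅ G) (n : ℕ) :
    F.rightDerived n ≅ G.rightDerived n where
  hom := NatTrans.rightDerived α.hom n
  inv := NatTrans.rightDerived α.inv n
  hom_inv_id := by rw [← NatTrans.rightDerived_comp, α.hom_inv_id, NatTrans.rightDerived_id]
  inv_hom_id := by rw [← NatTrans.rightDerived_comp, α.inv_hom_id, NatTrans.rightDerived_id]

/-- Right derived functors of a linear functor are linear. -/
theorem rightDerived_linear {R : Type*} [CommRing R] [Linear R C] [Linear R D] (F : C ⥤ D)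
    [F.Additive] [F.Linear R] (n : ℕ) : (F.rightDerived n).Linear R := by
  rw [Functor.linear_iff]
  intro X r
  let P := injectiveResolution X
  have h0 : augmentation P ≫ (r • 𝟙 P.cocomplex : P.cocomplex ⟶ P.cocomplex).f 0 =
      (r • 𝟙 X) ≫ augmentation P := by simp
  have h1 := P.isoRightDerivedObj_hom_naturality (r • 𝟙 X) P (r • 𝟙 P.cocomplex) h0 F n
  have h2 : (F.mapHomologicalComplex _ ⋙ HomologicalComplex.homologyFunctor _ _ n).map
      (r • 𝟙 P.cocomplex) = r • 𝟙 _ := by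
    rw [Functor.comp_map, Functor.map_smul, CategoryTheory.Functor.map_id]
    refine (ShortComplex.homologyMap_smul (𝟙 _) r).trans ?_
    rw [ShortComplex.homologyMap_id]
    rfl
  rw [← cancel_mono (P.isoRightDerivedObj F n).hom, h1, h2]
  simp

end DerivedComp

/-! ### Restriction of scalars and the theorem. -/

variable {R R' : Type u} [CommRing R] [CommRing R']

instance torsionFunctor_linear (I J : Ideal R) : (torsionFunctor I J).Linear R where
  map_smul _ _ := rfl

instance restrictScalars_preservesHomology (φ : R →+* R') :
    (ModuleCat.restrictScalars.{u} φ).PreservesHomology where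
  preservesKernels _ _ _ := inferInstance
  preservesCokernels _ _ _ := inferInstance

/-- The torsion functors over `R` and `R'` agree on `R'`-modules. -/
def restrictScalarsCompTorsionFunctorIso (I J : Ideal R) (φ : R →+* R')
    (hJ : φ '' (J : Set R) = (Ideal.map φ J : Set R')) :
    ModuleCat.restrictScalars.{u} φ ⋙ torsionFunctor I J ≅
      torsionFunctor (I.map φ) (J.map φ) ⋙ ModuleCat.restrictScalars.{u} φ :=
  NatIso.ofComponents (fun M =>
    let e : (ModuleCat.restrictScalars.{u} φ ⋙ torsionFunctor I J).obj M ≃ₗ[R]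
        (torsionFunctor (I.map φ) (J.map φ) ⋙ ModuleCat.restrictScalars.{u} φ).obj M :=
      { toFun := fun x => (⟨x.1, (isPairTorsion_map_iff I J φ hJ
          (M := (ModuleCat.restrictScalars φ).obj M) (fun _ _ => rfl) x.1).2 x.2⟩ :
            torsionSubmodule (I.map φ) (J.map φ) M)
        invFun := fun (x : torsionSubmodule (I.map φ) (J.map φ) M) =>
          ⟨x.1, (isPairTorsion_map_iff I J φ hJ
            (M := (ModuleCat.restrictScalars φ).obj M) (fun _ _ => rfl) x.1).1 x.2⟩
        map_add' := fun _ _ => rfl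
        map_smul' := fun _ _ => rfl
        left_inv := fun _ => rfl
        right_inv := fun _ => rfl }
    e.toModuleIso) (fun _ => rfl)

/-- A linear functor whose restriction of scalars is `G` recovers `liftAction G`. -/
theorem nonempty_liftAction_iso (φ : R →+* R') (G : ModuleCat.{u} R' ⥤ ModuleCat.{u} R)
    [G.Additive] (H : ModuleCat.{u} R' ⥤ ModuleCat.{u} R') [H.Linear R']
    (α : G ≅ H ⋙ ModuleCat.restrictScalars.{u} φ) : Nonempty (liftAction G ≅ H) := by
  let e (M : ModuleCat.{u} R') : (liftAction G).obj M ≃ₗ[R'] H.obj M :=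
    { toFun := fun x => (α.hom.app M).hom x
      invFun := fun x => (α.inv.app M).hom x
      map_add' := fun x y => map_add (α.hom.app M).hom x y
      map_smul' := fun r x => by
        have h := ConcreteCategory.congr_hom
          (α.hom.naturality (ModuleCat.ofHom (LinearMap.lsmul R' M r))) x
        have h1 : ModuleCat.ofHom (LinearMap.lsmul R' M r) = r • 𝟙 M := by ext; simp
        -- By linearity of `H`, the functorial action of `r` on `H.obj M` is its scalar action.
        have h2 : H.map (ModuleCat.ofHom (LinearMap.lsmul R' M r)) = r • 𝟙 (H.obj M) := by
          rw [h1, Functor.map_smul, CategoryTheory.Functor.map_id]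
        exact h.trans
          (congrArg (fun k : H.obj M ⟶ H.obj M => k.hom ((α.hom.app M).hom x)) h2)
      left_inv := fun x => ConcreteCategory.congr_hom (α.hom_inv_id_app M) x
      right_inv := fun x => ConcreteCategory.congr_hom (α.inv_hom_id_app M) x }
  refine ⟨NatIso.ofComponents (fun M => (e M).toModuleIso) fun f => ?_⟩
  ext x
  exact ConcreteCategory.congr_hom (α.hom.naturality f) x

theorem IsResolution.function_exact {K : CochainComplex (ModuleCat.{u} R) ℕ} {A : ModuleCat.{u} R}
    {ι : A ⟶ K.X 0} (h : IsResolution K ι) :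
    Function.Injective ι ∧ Function.Exact ι (K.d 0 1) ∧
      ∀ n, Function.Exact (K.d n (n + 1)) (K.d (n + 1) (n + 2)) :=
  ⟨(ModuleCat.mono_iff_injective ι).1 h.mono,
    (ShortComplex.ShortExact.moduleCat_exact_iff_function_exact _).1 h.exact₀,
    fun n => (ShortComplex.ShortExact.moduleCat_exact_iff_function_exact _).1 (h.exact_succ n)⟩

/-- This stands in for injectivity over `R`, which restriction of scalars can destroy. -/
theorem isTorsionDivisible_restrictScalars [IsNoetherianRing R'] (φ : R →+* R')
    (E : ModuleCat.{u} R') [Injective E] :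
    IsTorsionDivisible R ((ModuleCat.restrictScalars.{u} φ).obj E) := by
  have : Injective (ModuleCat.of R' E) := ‹_›
  have : Module.Injective R' E := Module.injective_module_of_injective_object R' E
  have : Module.Injective R' ((ModuleCat.restrictScalars.{u} φ).obj E) := this
  exact .of_injective φ fun _ _ => rfl

theorem isTorsionDivisible_of_injective [IsNoetherianRing R] (E : ModuleCat.{u} R)
    [Injective E] : IsTorsionDivisible R E := by
  have : Injective (ModuleCat.of R E) := ‹_›
  have : Module.Injective R E := Module.injective_module_of_injective_object R E
  exact .of_injective (RingHom.id R) fun _ _ => rfl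

end PairLocalCohomology

open PairLocalCohomology in
theorem theorem2p7 {R R' : Type u} [CommRing R] [IsNoetherianRing R]
    [CommRing R'] [IsNoetherianRing R'] (I J : Ideal R) (φ : R →+* R')
    (hJ : φ '' (J : Set R) = (Ideal.map φ J : Set R')) (i : ℕ) :
    Nonempty (PairLocalCohomology.localCohomologyAlong φ I J i ≅
      PairLocalCohomology.localCohomology (Ideal.map φ I) (Ideal.map φ J) i) := by
  have : (localCohomology (I.map φ) (J.map φ) i).Linear R' := rightDerived_linear _ i
  obtain ⟨α⟩ := nonempty_rightDerived_comp_iso (ModuleCat.restrictScalars.{u} φ)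
    (torsionFunctor I J) i (fun M P Q f hf => by
      have hP := ((isResolution_of_injectiveResolution P).map
        (ModuleCat.restrictScalars.{u} φ)).function_exact
      have hQ := (isResolution_of_injectiveResolution Q).function_exact
      exact isIso_homologyMap_torsionFunctor f _ _ hf hQ.1 hP.2.1 hQ.2.1 hP.2.2 hQ.2.2
        (fun n => isTorsionDivisible_restrictScalars φ (P.cocomplex.X n))
        (fun n => isTorsionDivisible_of_injective (Q.cocomplex.X n)) I J i)
  obtain ⟨β⟩ := nonempty_comp_rightDerived_iso (torsionFunctor (I.map φ) (J.map φ))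
    (ModuleCat.restrictScalars.{u} φ) i
  -- The isomorphisms chain over `R`; linearity of the derived functor over `R'` upgrades the result
  -- to `R'`-modules.
  exact nonempty_liftAction_iso φ _ _
    (α.symm ≪≫ rightDerivedIso (restrictScalarsCompTorsionFunctorIso I J φ hJ) i ≪≫ β)

end
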